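/- Let $n\ge 0$ and let $S_n$ be the symmetric group on $\{1,\dots,n\}$ with simple generators $s_i=(i\ i{+}1)$ and Coxeter length $\ell$. Let $\le_R$ be right weak order, the partial order on $S_n$ generated by the relations $u<us$ with $s$ a simple generator and $\ell(us)=\ell(u)+1$, and let $\preceq$ be Bruhat order, the partial order generated by the relations $u<ut$ with $t$ a transposition and $\ell(ut)=\ell(u)+1$. For $u\in S_n$ put $\boldsymbol u=(u^{-1}(1),\dots,u^{-1}(n))\in\mathbb R^n$. Fix $w\in S_n$, write $[e,w]=\{u\in S_n: u\preceq w\}$, and let $Q_w=\operatorname{conv}\{\boldsymbol u: u\in[e,w]\}$ be the Bruhat interval polytope. Let $P_w$ be the set $[e,w]$ with the partial order $\le_w$ generated by the relations $u<_w v$ whenever $Q_w$ has an edge between $\boldsymbol u$ and $\boldsymbol v$ and $\ell(u)<\ell(v)$. For $y\in S_n$ let $C(y)=\{c\in\mathbb R^n: c_{y(1)}\le c_{y(2)}\le\dots\le c_{y(n)}\}$, and for $u\in[e,w]$ let $C_w(u)=\{c\in\mathbb R^n: \langle c,p\rangle\le\langle c,\boldsymbol u\rangle \text{ for all } p\in Q_w\}$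 be the normal cone of $Q_w$ at $\boldsymbol u$. Let $\Theta_w$ be the relation on $S_n$ in which $x$ and $y$ are related if and only if $C(x)$ and $C(y)$ are contained in a common cone $C_w(u)$ with $u\in[e,w]$. Then $\Theta_w$ is an equivalence relation, and for every $x\in S_n$ the class $[x]_w$ of $x$ has a minimum $\mathrm{Bot}_w(x)$ and a maximum $\mathrm{Top}_w(x)$ with respect to $\le_R$. The map $\mathrm{Top}_w:S_n\to S_n$ is order preserving: if $x\le_R y$, then $\mathrm{Top}_w(x)\le_R\mathrm{Top}_w(y)$. Moreover, let the set $S_n/\Theta_w$ of classes be ordered by $[x]_w\le[y]_w$ if and only if $x'\le_R y'$ for some $x'\in[x]_w$ and $y'\in[y]_w$. Then $[x]_w\mapsto\mathrm{Bot}_w(x)$ is a well-defined isomorphism of posets from $S_n/\Theta_w$ onto $P_w$. -/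

import Mathlib

noncomputable section

namespace BruhatPolytope

open Equiv

variable {n : ℕ}

/-! ### Length, weak order and Bruhat order on `S_n = Perm (Fin n)`

Products are compositions of maps, so right multiplication acts on positions. -/

/-- The simple generators: the adjacent transpositions `(i i+1)`. -/
def IsSimple (s : Perm (Fin n)) : Prop :=
  ∃ i j : Fin n, (j : ℕ) = i + 1 ∧ s = swap i j

/-- The Coxeter length: the least length of a word in the simple generators with product `w`. -/
def length (w : Perm (Fin n)) : ℕ :=
  sInf {k | ∃ l : List (Perm (Fin n)), (∀ s ∈ l, IsSimple s) ∧ l.prod = w ∧ l.length = k}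

/-- Cover relations of right weak order. -/
def WeakCover (u v : Perm (Fin n)) : Prop :=
  ∃ s, IsSimple s ∧ v = u * s ∧ length (u * s) = length u + 1

/-- Right weak order. -/
def WeakLE : Perm (Fin n) → Perm (Fin n) → Prop := Relation.ReflTransGen WeakCover

/-- Cover relations of Bruhat order. -/
def BruhatCover (u v : Perm (Fin n)) : Prop :=
  ∃ t : Perm (Fin n), t.IsSwap ∧ v = u * t ∧ length (u * t) = length u + 1

/-- (Strong) Bruhat order. -/
def BruhatLE : Perm (Fin n) → Perm (Fin n) → Prop := Relation.ReflTransGen BruhatCover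

/-! ### The Bruhat interval polytope and its 1-skeleton poset -/

/-- The vector `(u⁻¹(1), …, u⁻¹(n))`; the `+ 1` makes up for `Fin n` starting at `0`. -/
def vec (u : Perm (Fin n)) : Fin n → ℝ := fun i => ((u⁻¹ i : Fin n) : ℕ) + 1

/-- The Bruhat interval polytope `Q_w`. -/
def Q (w : Perm (Fin n)) : Set (Fin n → ℝ) :=
  convexHull ℝ {p | ∃ u, BruhatLE u w ∧ p = vec u}

/-- `Q_w` has an edge (a one-dimensional face) with endpoints `vec u` and `vec v`. -/
def IsEdge (w u v : Perm (Fin n)) : Prop :=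
  vec u ≠ vec v ∧ IsExposed ℝ (Q w) (segment ℝ (vec u) (vec v))

/-- The underlying set of `P_w`: the lower Bruhat interval `[e, w]`. -/
def P (w : Perm (Fin n)) : Type := {u : Perm (Fin n) // BruhatLE u w}

/-- The edges of `Q_w`, directed towards greater length. -/
def UpEdge (w : Perm (Fin n)) (u v : P w) : Prop :=
  IsEdge w u.1 v.1 ∧ length u.1 < length v.1

theorem eq_or_length_lt {w : Perm (Fin n)} {u v : P w}
    (h : Relation.ReflTransGen (UpEdge w) u v) : u = v ∨ length u.1 < length v.1 := by
  induction h with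
  | refl => exact Or.inl rfl
  | tail _ h ih =>
    rcases ih with rfl | ih
    · exact Or.inr h.2
    · exact Or.inr (ih.trans h.2)

/-- The 1-skeleton poset `(P_w, ≤_w)`, generated by the upward edges. -/
instance (w : Perm (Fin n)) : PartialOrder (P w) where
  le := Relation.ReflTransGen (UpEdge w)
  le_refl _ := Relation.ReflTransGen.refl
  le_trans _ _ _ := Relation.ReflTransGen.trans
  le_antisymm _ _ h h' := by
    rcases eq_or_length_lt h with e | l
    · exact e
    · rcases eq_or_length_lt h' with e | l'
      · exact e.symm
      · exact absurd (l.trans l') (lt_irrefl _)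

/-! ### Normal fans and the equivalence relation `Θ_w` -/

/-- The top-dimensional cone `C(y)` of the braid arrangement: the points whose coordinates are in
the relative order prescribed by `y`, that is `c (y 1) ≤ c (y 2) ≤ … ≤ c (y n)`. -/
def braidCone (y : Perm (Fin n)) : Set (Fin n → ℝ) :=
  {c | ∀ i j, i ≤ j → c (y i) ≤ c (y j)}

/-- The (outer) normal cone `C_w(u)` of `Q_w` at the vertex `vec u`: the functionals that attain
their maximum over `Q_w` at `vec u`. For `u ∈ [e, w]` these are the top-dimensional cones of the
normal fan of `Q_w`. -/
def normalCone (w u : Perm (Fin n)) : Set (Fin n → ℝ) :=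
  {c | ∀ p ∈ Q w, c ⬝ᵥ p ≤ c ⬝ᵥ vec u}

/-- The relation `Θ_w` induced by the normal fan of `Q_w`: the cones `C(x)` and `C(y)` lie in the
same top-dimensional cone of the normal fan. -/
def Theta (w x y : Perm (Fin n)) : Prop :=
  ∃ u, BruhatLE u w ∧ braidCone x ⊆ normalCone w u ∧ braidCone y ⊆ normalCone w u

/-- `m` is the maximum of the class `[x]_w` in right weak order. -/
def IsClassMax (w x m : Perm (Fin n)) : Prop :=
  Theta w x m ∧ ∀ y, Theta w x y → WeakLE y m

/-- `m` is the minimum of the class `[x]_w` in right weak order. -/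
def IsClassMin (w x m : Perm (Fin n)) : Prop :=
  Theta w x m ∧ ∀ y, Theta w x y → WeakLE m y

/-- `Top_w(x)`, the maximum of `[x]_w` in right weak order. -/
def Top (w x : Perm (Fin n)) : Perm (Fin n) := Classical.epsilon (IsClassMax w x)

/-- `Bot_w(x)`, the minimum of `[x]_w` in right weak order. -/
def Bot (w x : Perm (Fin n)) : Perm (Fin n) := Classical.epsilon (IsClassMin w x)

/-- The set of classes of `Θ_w`. -/
def WeakQuotient (w : Perm (Fin n)) : Type := Quot (Theta w)

/-- The class `[x]_w`. -/
def cls (w x : Perm (Fin n)) : WeakQuotient w := Quot.mk (Theta w) x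

/-- The quotient of right weak order by `Θ_w`: one class is below another if some representative
of the first is below some representative of the second. -/
instance (w : Perm (Fin n)) : LE (WeakQuotient w) where
  le a b := ∃ x y : Perm (Fin n), cls w x = a ∧ cls w y = b ∧ WeakLE x y

end BruhatPolytope

end

/-! For `x` in `S_n` there is a unique `u` in `[e, w]` for which `x⁻¹ * u` is Bruhat-minimal; call
it `nearest w x`. If `c` lies in `C(x)`, then `c ⬝ᵥ vec (x * a)` weakly decreases as `a` goes up in
Bruhat order, so `nearest w x` maximizes every such `c` over `Q_w`. Hence `C(x)` lies in `C_w(u)`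
exactly when `nearest w x = u`, and `Θ_w` is the fibre relation of `nearest` (`theta_iff`). Since
`nearest w x` lies weakly below `x` and `nearest` fixes `[e, w]`, it is the minimum of the class.

Crossing a wall from `x` to `x * s` upward either fixes `nearest` or moves it up an edge of `Q_w`,
because a generic functional on the wall has at most two maximizing vertices (`nearest_le_nearest`).
Conversely, every upward edge lifts to a weak order relation between representatives
(`exists_weakLE_of_upEdge`): sort the values by a functional that exposes the edge and break ties in
two ways.

To chain lifted edges, the relation on classes must be transitive, which follows from monotonicity
of `Top`. Each class consists of the linear extensions of a partial order on values, `ClassLT`. If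
`a < m < b` and `a` is forced before `b`, then `a` is forced before `m` or `m` before `b`
(`ClassLT.or_of_between`). So putting every unforced pair in reversed order gives a permutation, the
class maximum. When a cover `x < x * s` changes class, the two values it exchanges are also adjacent
in that maximum, and exchanging them there lands in the new class (`classTop_le_classTop_of_cover`).
-/

namespace BruhatPolytope

open Equiv

/-! ### Inversions, length and weak order -/

section Inversions

variable {n : ℕ}

/-- The set of inversions of `u`, as pairs of values. -/
def inversions (u : Perm (Fin n)) : Finset (Fin n × Fin n) :=
  {ab | ab.1 < ab.2 ∧ u⁻¹ ab.2 < u⁻¹ ab.1}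

theorem mem_inversions {u : Perm (Fin n)} {a b : Fin n} :
    (a, b) ∈ inversions u ↔ a < b ∧ u⁻¹ b < u⁻¹ a := by
  simp [inversions]

theorem swap_lt_swap_iff_of_adjacent {i j p q : Fin n} (hij : (j : ℕ) = i + 1)
    (h : ¬(p = i ∧ q = j)) (h' : ¬(p = j ∧ q = i)) : swap i j p < swap i j q ↔ p < q := by
  simp only [swap_apply_def]
  split_ifs <;> simp only [Fin.lt_def, Fin.ext_iff] at * <;> omega

theorem inversions_mul_swap {u : Perm (Fin n)} {i j : Fin n} (hij : (j : ℕ) = i + 1)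
    (h : u i < u j) : inversions (u * swap i j) = insert (u i, u j) (inversions u) := by
  have hlt : i < j := by rw [Fin.lt_def]; omega
  ext ⟨a, b⟩
  simp only [Finset.mem_insert, mem_inversions, mul_inv_rev, Perm.mul_apply, swap_inv,
    Prod.mk.injEq]
  by_cases h1 : u⁻¹ b = i ∧ u⁻¹ a = j
  · obtain ⟨hb, ha⟩ := h1
    have hb' : b = u i := by rw [← hb]; simp
    have ha' : a = u j := by rw [← ha]; simp
    subst hb' ha'
    simp [h.not_gt, h.ne']
  by_cases h2 : u⁻¹ b = j ∧ u⁻¹ a = i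
  · obtain ⟨hb, ha⟩ := h2
    have hb' : b = u j := by rw [← hb]; simp
    have ha' : a = u i := by rw [← ha]; simp
    subst hb' ha'
    simp [h, hlt]
  · rw [swap_lt_swap_iff_of_adjacent hij h1 h2]
    constructor
    · exact Or.inr
    · rintro (⟨rfl, rfl⟩ | h3)
      · simp at h2
      · exact h3

theorem notMem_inversions {u : Perm (Fin n)} {i j : Fin n} (hij : i < j) :
    (u i, u j) ∉ inversions u := by
  simp [mem_inversions, hij.le]

theorem card_inversions_mul_swap {u : Perm (Fin n)} {i j : Fin n} (hij : (j : ℕ) = i + 1)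
    (h : u i < u j) : (inversions (u * swap i j)).card = (inversions u).card + 1 := by
  rw [inversions_mul_swap hij h, Finset.card_insert_of_notMem]
  exact notMem_inversions (by rw [Fin.lt_def]; omega)

theorem card_inversions_mul_swap' {u : Perm (Fin n)} {i j : Fin n} (hij : (j : ℕ) = i + 1)
    (h : u j < u i) : (inversions u).card = (inversions (u * swap i j)).card + 1 := by
  rw [← card_inversions_mul_swap hij (u := u * swap i j) (by simpa using h), mul_assoc,
    swap_mul_self, mul_one]

theorem eq_one_of_adjacent_lt {u : Perm (Fin n)}
    (h : ∀ i j : Fin n, (j : ℕ) = i + 1 → u i < u j) : u = 1 := by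
  have hm : StrictMono u := by
    cases n with
    | zero => exact fun a => a.elim0
    | succ n => exact Fin.strictMono_iff_lt_succ.2 fun i => h _ _ (by simp)
  have : hm.orderIsoOfSurjective u u.surjective = OrderIso.refl _ := Subsingleton.elim _ _
  ext i
  have := congrArg (fun f : Fin n ≃o Fin n => (f i : ℕ)) this
  simpa using this

theorem exists_descent {u : Perm (Fin n)} (h : u ≠ 1) :
    ∃ i j : Fin n, (j : ℕ) = i + 1 ∧ u j < u i := by
  by_contra! hc
  refine h (eq_one_of_adjacent_lt fun i j hij => lt_of_le_of_ne (hc i j hij) fun e => ?_)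
  have := congrArg Fin.val (u.injective e)
  omega

theorem inversions_one : inversions (1 : Perm (Fin n)) = ∅ := by
  ext ⟨a, b⟩
  simp only [mem_inversions, inv_one, Perm.coe_one, id_eq, Finset.notMem_empty, iff_false, not_and]
  exact fun h => h.not_gt

theorem exists_word (k : ℕ) : ∀ u : Perm (Fin n), (inversions u).card = k →
    ∃ l : List (Perm (Fin n)), (∀ s ∈ l, IsSimple s) ∧ l.prod = u ∧ l.length = k := by
  induction k with
  | zero =>
    intro u hu
    refine ⟨[], by simp, ?_, rfl⟩
    by_contra hne
    obtain ⟨i, j, hij, h⟩ := exists_descent (Ne.symm hne)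
    have := card_inversions_mul_swap' hij h
    omega
  | succ k ih =>
    intro u hu
    have hne : u ≠ 1 := by
      rintro rfl
      simp [inversions_one] at hu
    obtain ⟨i, j, hij, h⟩ := exists_descent hne
    have := card_inversions_mul_swap' hij h
    obtain ⟨l, hl, hp, hk⟩ := ih (u * swap i j) (by omega)
    refine ⟨l ++ [swap i j], ?_, by simp [hp, mul_assoc], by simp [hk]⟩
    intro s hs
    rcases List.mem_append.1 hs with hs | hs
    · exact hl s hs
    · rw [List.mem_singleton.1 hs]
      exact ⟨i, j, hij, rfl⟩

theorem card_inversions_prod_le (l : List (Perm (Fin n))) (hl : ∀ s ∈ l, IsSimple s) :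
    (inversions l.prod).card ≤ l.length := by
  induction l using List.reverseRecOn with
  | nil => simp [inversions_one]
  | append_singleton l s ih =>
    obtain ⟨i, j, hij, rfl⟩ := hl s (by simp)
    have ih := ih fun s hs => hl s (by simp [hs])
    have hne : l.prod i ≠ l.prod j := fun e => by
      have := congrArg Fin.val (l.prod.injective e); omega
    simp only [List.prod_append, List.prod_singleton, List.length_append, List.length_singleton]
    rcases hne.lt_or_gt with h | h
    · have := card_inversions_mul_swap hij h; omega
    · have := card_inversions_mul_swap' hij h; omega

/-- Removing descents one at a time spells a word of this length, and each generator changes the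
inversion count by one, so no word is shorter. -/
theorem length_eq_card_inversions (u : Perm (Fin n)) : length u = (inversions u).card := by
  apply le_antisymm
  · exact Nat.sInf_le (exists_word _ u rfl)
  · obtain ⟨l, hl, rfl, hk⟩ := Nat.sInf_mem (⟨_, exists_word _ u rfl⟩ : Set.Nonempty {k | ∃ l :
      List (Perm (Fin n)), (∀ s ∈ l, IsSimple s) ∧ l.prod = u ∧ l.length = k})
    rw [length, ← hk]
    exact card_inversions_prod_le l hl

theorem length_mul_swap {u : Perm (Fin n)} {i j : Fin n} (hij : (j : ℕ) = i + 1)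
    (h : u i < u j) : length (u * swap i j) = length u + 1 := by
  simpa only [length_eq_card_inversions] using card_inversions_mul_swap hij h

theorem length_mul_swap' {u : Perm (Fin n)} {i j : Fin n} (hij : (j : ℕ) = i + 1)
    (h : u j < u i) : length u = length (u * swap i j) + 1 := by
  simpa only [length_eq_card_inversions] using card_inversions_mul_swap' hij h

theorem apply_ne_of_adjacent (u : Perm (Fin n)) {i j : Fin n} (hij : (j : ℕ) = i + 1) :
    u i ≠ u j := fun e => by
  have := congrArg Fin.val (u.injective e); omega

theorem weakCover_iff {u v : Perm (Fin n)} : WeakCover u v ↔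
    ∃ i j : Fin n, (j : ℕ) = i + 1 ∧ u i < u j ∧ v = u * swap i j := by
  constructor
  · rintro ⟨_, ⟨i, j, hij, rfl⟩, rfl, hl⟩
    refine ⟨i, j, hij, ?_, rfl⟩
    rcases (apply_ne_of_adjacent u hij).lt_or_gt with h | h
    · exact h
    · have := length_mul_swap' hij h; omega
  · rintro ⟨i, j, hij, h, rfl⟩
    exact ⟨_, ⟨i, j, hij, rfl⟩, rfl, length_mul_swap hij h⟩

theorem WeakLE.inversions_subset {u v : Perm (Fin n)} (h : WeakLE u v) :
    inversions u ⊆ inversions v := by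
  induction h with
  | refl => exact subset_rfl
  | tail _ h ih =>
    obtain ⟨i, j, hij, hlt, rfl⟩ := weakCover_iff.1 h
    rw [inversions_mul_swap hij hlt]
    exact ih.trans (Finset.subset_insert _ _)

/-- If `u` lies strictly below `x`, then some simple step up from `u` stays below `x`. -/
theorem exists_adjacent_of_inversions_subset {u x : Perm (Fin n)}
    (h : inversions u ⊆ inversions x) (hne : u ≠ x) :
    ∃ i j : Fin n, (j : ℕ) = i + 1 ∧ u i < u j ∧ inversions (u * swap i j) ⊆ inversions x := by
  by_contra! hc
  -- If no step is available, `x⁻¹ * u` has no descent and is therefore the identity.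
  refine hne (inv_mul_eq_one.1 (eq_one_of_adjacent_lt (u := x⁻¹ * u) fun i j hij => ?_)).symm
  have hlt : i < j := by rw [Fin.lt_def]; omega
  simp only [Perm.mul_apply]
  rcases (apply_ne_of_adjacent u hij).lt_or_gt with h1 | h1
  · by_contra h2
    refine hc i j hij h1 ?_
    rw [inversions_mul_swap hij h1]
    refine Finset.insert_subset (mem_inversions.2 ⟨h1, lt_of_le_of_ne (not_lt.1 h2) fun e => ?_⟩) h
    exact h1.ne' (x⁻¹.injective e)
  · exact (mem_inversions.1 (h (mem_inversions.2 ⟨h1, by simpa using hlt⟩))).2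

theorem weakLE_iff {u x : Perm (Fin n)} : WeakLE u x ↔ inversions u ⊆ inversions x := by
  refine ⟨WeakLE.inversions_subset, fun h => ?_⟩
  obtain ⟨k, hk⟩ : ∃ k, k = (inversions x).card - (inversions u).card := ⟨_, rfl⟩
  induction k using Nat.strong_induction_on generalizing u with
  | _ k ih =>
    by_cases hne : u = x
    · subst hne; exact Relation.ReflTransGen.refl
    · obtain ⟨i, j, hij, hlt, hs⟩ := exists_adjacent_of_inversions_subset h hne
      have h1 := card_inversions_mul_swap hij hlt
      have h2 := Finset.card_le_card hs
      exact Relation.ReflTransGen.head (weakCover_iff.2 ⟨i, j, hij, hlt, rfl⟩)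
        (ih _ (by omega) hs rfl)

theorem inversions_injective : Function.Injective (inversions (n := n)) := by
  intro u x h
  by_contra hne
  obtain ⟨i, j, hij, hlt, hs⟩ := exists_adjacent_of_inversions_subset h.subset hne
  have h1 := card_inversions_mul_swap hij hlt
  have h2 := Finset.card_le_card hs
  rw [h] at h1
  omega

theorem WeakLE.antisymm {u v : Perm (Fin n)} (h : WeakLE u v) (h' : WeakLE v u) : u = v :=
  inversions_injective (h.inversions_subset.antisymm h'.inversions_subset)

/-- Every strict total order on `Fin n` lists the elements in the order of a permutation. -/
theorem exists_perm_of_strictTotalOrder (r : Fin n → Fin n → Prop) (hirr : ∀ a, ¬r a a)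
    (htrans : ∀ a b c, r a b → r b c → r a c) (htot : ∀ a b, a ≠ b → r a b ∨ r b a) :
    ∃ y : Perm (Fin n), ∀ a b, y⁻¹ a < y⁻¹ b ↔ r a b := by
  classical
  -- The rank of `a`: the number of elements that precede it.
  let g : Fin n → Fin n := fun a => ⟨(Finset.univ.filter (r · a)).card, by
    refine (Finset.card_lt_univ_of_notMem (x := a) ?_).trans_eq (Fintype.card_fin n)
    simpa using hirr a⟩
  have hg : ∀ a b, r a b → g a < g b := by
    intro a b hab
    refine Fin.mk_lt_mk.2 <| Finset.card_lt_card (Finset.ssubset_iff_of_subset ?_ |>.2 ⟨a, ?_, ?_⟩)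
    · intro c hc
      simp only [Finset.mem_filter, Finset.mem_univ, true_and] at hc ⊢
      exact htrans _ _ _ hc hab
    · simpa using hab
    · simpa using hirr a
  have hinj : Function.Injective g := by
    intro a b hab
    by_contra hne
    rcases htot a b hne with h | h
    · exact (hg _ _ h).ne hab
    · exact (hg _ _ h).ne hab.symm
  let e : Perm (Fin n) := Equiv.ofBijective g (Finite.injective_iff_bijective.1 hinj)
  refine ⟨e⁻¹, fun a b => ?_⟩
  rw [inv_inv]
  refine ⟨fun h => ?_, hg a b⟩
  by_contra hab
  rcases eq_or_ne a b with rfl | hne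
  · exact lt_irrefl _ h
  · rcases htot a b hne with h1 | h1
    · exact hab h1
    · exact (hg _ _ h1).not_gt h

end Inversions

/-! ### Bruhat order -/

section Bruhat

variable {n : ℕ}

theorem swap_conj_adjacent {p r q : Fin n} (hpq : p ≠ q) (hrq : r ≠ q) :
    swap p q = swap p r * swap r q * swap p r := by
  rw [swap_comm p r, ← swap_mul_swap_mul_swap (x := q) (y := r) (z := p) hrq.symm hpq.symm]
  simp [swap_comm, mul_assoc]

/-- Induction on the distance `q - p`, writing `(p q) = (p r)(r q)(p r)` with `r = p + 1`. The
middle factor lengthens by induction, and the two outer ones cannot both shorten, since `u r < u p`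
and `u q < u r` would contradict `u p < u q`. -/
theorem length_lt_mul_swap_aux (d : ℕ) : ∀ (u : Perm (Fin n)) (p q : Fin n),
    (q : ℕ) = p + d + 1 → u p < u q → length u < length (u * swap p q) := by
  induction d with
  | zero =>
    intro u p q hd h
    have := length_mul_swap (by omega) h
    omega
  | succ d ih =>
    intro u p q hd h
    let r : Fin n := ⟨p + 1, by omega⟩
    have hr : (r : ℕ) = p + 1 := rfl
    have hpr : p ≠ r := fun e => by rw [Fin.ext_iff] at e; omega
    have hpq : p ≠ q := fun e => by rw [Fin.ext_iff] at e; omega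
    have hrq : r ≠ q := fun e => by rw [Fin.ext_iff] at e; omega
    have h1 := ih (u * swap p r) r q (by omega)
      (by simpa [swap_apply_of_ne_of_ne hpq.symm hrq.symm] using h)
    have hp : (u * swap p r * swap r q) p = u r := by
      simp [swap_apply_of_ne_of_ne hpr hpq]
    have hr' : (u * swap p r * swap r q) r = u q := by
      simp [swap_apply_of_ne_of_ne hpq.symm hrq.symm]
    have e : u * swap p q = u * swap p r * swap r q * swap p r := by
      rw [swap_conj_adjacent hpq hrq]; simp [mul_assoc]
    rw [e]
    rcases (u.injective.ne hpr).lt_or_gt with h2 | h2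
    · have h3 := length_mul_swap hr h2
      rcases (u.injective.ne hrq).lt_or_gt with h4 | h4
      · have := length_mul_swap hr (u := u * swap p r * swap r q) (by rw [hp, hr']; exact h4)
        omega
      · have := length_mul_swap' hr (u := u * swap p r * swap r q) (by rw [hp, hr']; exact h4)
        omega
    · have h3 := length_mul_swap' hr h2
      have := length_mul_swap hr (u := u * swap p r * swap r q)
        (by rw [hp, hr']; exact h2.trans h)
      omega

theorem length_lt_mul_swap {u : Perm (Fin n)} {p q : Fin n} (hpq : p < q) (h : u p < u q) :
    length u < length (u * swap p q) :=
  length_lt_mul_swap_aux (q - p - 1) u p q (by rw [Fin.lt_def] at hpq; omega) h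

theorem length_mul_swap_lt {u : Perm (Fin n)} {p q : Fin n} (hpq : p < q) (h : u q < u p) :
    length (u * swap p q) < length u := by
  simpa [mul_assoc] using length_lt_mul_swap (u := u * swap p q) hpq (by simpa using h)

theorem BruhatCover.exists_swap {u v : Perm (Fin n)} (h : BruhatCover u v) :
    ∃ p q : Fin n, p < q ∧ u p < u q ∧ v = u * swap p q ∧ length v = length u + 1 := by
  obtain ⟨t, ⟨p, q, hne, rfl⟩, rfl, hl⟩ := h
  wlog hpq : p < q generalizing p q
  · rw [swap_comm p q] at hl ⊢
    exact this q p hne.symm hl (lt_of_le_of_ne (not_lt.1 hpq) hne.symm)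
  refine ⟨p, q, hpq, ?_, rfl, hl⟩
  rcases (u.injective.ne hne).lt_or_gt with h | h
  · exact h
  · have := length_mul_swap_lt hpq h
    omega

theorem bruhatLE_mul_swap_adjacent {u : Perm (Fin n)} {i j : Fin n} (hij : (j : ℕ) = i + 1)
    (h : u i < u j) : BruhatLE u (u * swap i j) :=
  Relation.ReflTransGen.single ⟨_, ⟨i, j, by rintro rfl; omega, rfl⟩, rfl, length_mul_swap hij h⟩

theorem bruhatLE_mul_swap_adjacent' {u : Perm (Fin n)} {i j : Fin n} (hij : (j : ℕ) = i + 1)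
    (h : u j < u i) : BruhatLE (u * swap i j) u := by
  simpa [mul_assoc] using bruhatLE_mul_swap_adjacent (u := u * swap i j) hij (by simpa using h)

theorem BruhatLE.eq_or_length_lt {u v : Perm (Fin n)} (h : BruhatLE u v) :
    u = v ∨ length u < length v := by
  induction h with
  | refl => exact Or.inl rfl
  | tail _ h ih =>
    obtain ⟨_, _, _, _, _, hl⟩ := h.exists_swap
    rcases ih with rfl | ih
    · right; omega
    · right; omega

theorem BruhatLE.antisymm {u v : Perm (Fin n)} (h : BruhatLE u v) (h' : BruhatLE v u) :
    u = v := by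
  rcases h.eq_or_length_lt with e | l
  · exact e
  · rcases h'.eq_or_length_lt with e | l'
    · exact e.symm
    · omega

theorem BruhatLE.trans {u v x : Perm (Fin n)} (h : BruhatLE u v) (h' : BruhatLE v x) :
    BruhatLE u x :=
  Relation.ReflTransGen.trans h h'

theorem length_one : length (1 : Perm (Fin n)) = 0 := by
  rw [length_eq_card_inversions, inversions_one, Finset.card_empty]

theorem BruhatLE.eq_one {u : Perm (Fin n)} (h : BruhatLE u 1) : u = 1 := by
  rcases h.eq_or_length_lt with e | l
  · exact e
  · rw [length_one] at l; omega

/-- The lifting property for covers. Conjugating the transposition by the simple generator keeps it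
length-increasing unless the two coincide; the cases are whether `i` is an ascent of `u` and of `v`.
-/
theorem BruhatCover.mul_swap_adjacent {u v : Perm (Fin n)} {i j : Fin n}
    (hij : (j : ℕ) = i + 1) (h : BruhatCover u v) :
    v = u * swap i j ∨ BruhatLE (u * swap i j) (v * swap i j) := by
  obtain ⟨p, q, hpq, hlt, rfl, hl⟩ := h.exists_swap
  by_cases hs : p = i ∧ q = j
  · left; rw [hs.1, hs.2]
  right
  have hconj : u * swap p q * swap i j = u * swap i j * swap (swap i j p) (swap i j q) := by
    rw [mul_assoc, mul_assoc, Equiv.swap_apply_apply]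
    simp [mul_assoc]
  have hpq' : swap i j p < swap i j q := by
    rwa [swap_lt_swap_iff_of_adjacent hij hs]
    rintro ⟨rfl, rfl⟩
    rw [Fin.lt_def] at hpq; omega
  have hlen : length (u * swap i j) < length (u * swap p q * swap i j) := by
    rw [hconj]
    exact length_lt_mul_swap hpq' (by simpa using hlt)
  have hcov : length (u * swap p q * swap i j) = length (u * swap i j) + 1 →
      BruhatLE (u * swap i j) (u * swap p q * swap i j) := fun he => by
    rw [hconj] at he ⊢
    exact Relation.ReflTransGen.single ⟨_, ⟨_, _, hpq'.ne, rfl⟩, rfl, he⟩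
  rcases (apply_ne_of_adjacent u hij).lt_or_gt with h1 | h1 <;>
  rcases (apply_ne_of_adjacent (u * swap p q) hij).lt_or_gt with h2 | h2
  · have := length_mul_swap hij h1
    have := length_mul_swap hij h2
    exact hcov (by omega)
  · have := length_mul_swap hij h1
    have := length_mul_swap' hij h2
    omega
  · exact ((bruhatLE_mul_swap_adjacent' hij h1).trans (Relation.ReflTransGen.single h)).trans
      (bruhatLE_mul_swap_adjacent hij h2)
  · have := length_mul_swap' hij h1
    have := length_mul_swap' hij h2
    exact hcov (by omega)

/-- The shorter one of `u` and `u * swap i j`, for adjacent `i` and `j`. -/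
def stepMin (i j : Fin n) (u : Perm (Fin n)) : Perm (Fin n) :=
  if u i < u j then u else u * swap i j

/-- The longer one of `u` and `u * swap i j`, for adjacent `i` and `j`. -/
def stepMax (i j : Fin n) (u : Perm (Fin n)) : Perm (Fin n) :=
  if u i < u j then u * swap i j else u

theorem stepMin_mul_swap {i j : Fin n} (hij : (j : ℕ) = i + 1) (u : Perm (Fin n)) :
    stepMin i j (u * swap i j) = stepMin i j u := by
  have := apply_ne_of_adjacent u hij
  rcases this.lt_or_gt with h | h <;> simp [stepMin, h, h.not_gt, mul_assoc]

theorem stepMax_mul_swap {i j : Fin n} (hij : (j : ℕ) = i + 1) (u : Perm (Fin n)) :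
    stepMax i j (u * swap i j) = stepMax i j u := by
  have := apply_ne_of_adjacent u hij
  rcases this.lt_or_gt with h | h <;> simp [stepMax, h, h.not_gt, mul_assoc]

theorem stepMin_le {i j : Fin n} (hij : (j : ℕ) = i + 1) (u : Perm (Fin n)) :
    BruhatLE (stepMin i j u) u := by
  rcases (apply_ne_of_adjacent u hij).lt_or_gt with h | h
  · rw [stepMin, if_pos h]; exact Relation.ReflTransGen.refl
  · rw [stepMin, if_neg h.not_gt]; exact bruhatLE_mul_swap_adjacent' hij h

theorem le_stepMax {i j : Fin n} (hij : (j : ℕ) = i + 1) (u : Perm (Fin n)) :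
    BruhatLE u (stepMax i j u) := by
  rcases (apply_ne_of_adjacent u hij).lt_or_gt with h | h
  · rw [stepMax, if_pos h]; exact bruhatLE_mul_swap_adjacent hij h
  · rw [stepMax, if_neg h.not_gt]; exact Relation.ReflTransGen.refl

theorem BruhatLE.stepMin_le_stepMin {u v : Perm (Fin n)} {i j : Fin n} (hij : (j : ℕ) = i + 1)
    (h : BruhatLE u v) : BruhatLE (stepMin i j u) (stepMin i j v) := by
  induction h with
  | refl => exact Relation.ReflTransGen.refl
  | @tail v x _ h ih =>
    refine ih.trans ?_
    rcases h.mul_swap_adjacent hij with rfl | h'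
    · rw [stepMin_mul_swap hij]; exact Relation.ReflTransGen.refl
    · by_cases hx : x i < x j
      · rw [stepMin.eq_def i j x, if_pos hx]
        exact (stepMin_le hij v).trans (Relation.ReflTransGen.single h)
      · rw [stepMin.eq_def i j x, if_neg hx, ← stepMin_mul_swap hij]
        exact (stepMin_le hij _).trans h'

theorem BruhatLE.stepMax_le_stepMax {u v : Perm (Fin n)} {i j : Fin n} (hij : (j : ℕ) = i + 1)
    (h : BruhatLE u v) : BruhatLE (stepMax i j u) (stepMax i j v) := by
  induction h with
  | refl => exact Relation.ReflTransGen.refl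
  | @tail v x _ h ih =>
    refine ih.trans ?_
    rcases h.mul_swap_adjacent hij with rfl | h'
    · rw [stepMax_mul_swap hij]; exact Relation.ReflTransGen.refl
    · by_cases hv : v i < v j
      · rw [stepMax.eq_def i j v, if_pos hv, ← stepMax_mul_swap hij x]
        exact BruhatLE.trans h' (le_stepMax hij _)
      · rw [stepMax.eq_def i j v, if_neg hv]
        exact BruhatLE.trans (Relation.ReflTransGen.single h) (le_stepMax hij x)

/-- Bruhat order is generated by transpositions that raise the length by exactly one; this admits
every length-increasing transposition. -/
theorem bruhatLE_mul_swap_aux (d : ℕ) : ∀ (u : Perm (Fin n)) (p q : Fin n),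
    (q : ℕ) = p + d + 1 → u p < u q → BruhatLE u (u * swap p q) := by
  induction d with
  | zero => exact fun u p q hd h => bruhatLE_mul_swap_adjacent (by omega) h
  | succ d ih =>
    intro u p q hd h
    let r : Fin n := ⟨p + 1, by omega⟩
    have hr : (r : ℕ) = p + 1 := rfl
    have hpr : p ≠ r := fun e => by rw [Fin.ext_iff] at e; omega
    have hpq : p ≠ q := fun e => by rw [Fin.ext_iff] at e; omega
    have hrq : r ≠ q := fun e => by rw [Fin.ext_iff] at e; omega
    have h1 := ih (u * swap p r) r q (by omega)
      (by simpa [swap_apply_of_ne_of_ne hpq.symm hrq.symm] using h)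
    have hp : (u * swap p q) p = u q := by simp
    have hr' : (u * swap p q) r = u r := by simp [swap_apply_of_ne_of_ne hpr.symm hrq]
    have e : u * swap p r * swap r q = u * swap p q * swap p r := by
      rw [swap_conj_adjacent hpq hrq]; simp [mul_assoc]
    rw [e] at h1
    -- `h1` compares `u * swap p r` with `u * swap p q * swap p r`. The trailing `swap p r` is
    -- cancelled on both sides by monotonicity of `stepMin` or `stepMax`, unless the outer steps
    -- already chain directly.
    rcases (u.injective.ne hpr).lt_or_gt with h2 | h2
    · rcases (u.injective.ne hrq).lt_or_gt with h4 | h4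
      · exact ((bruhatLE_mul_swap_adjacent hr h2).trans h1).trans
          (bruhatLE_mul_swap_adjacent' hr (by rw [hp, hr']; exact h4))
      · have := h1.stepMin_le_stepMin hr
        rwa [stepMin_mul_swap hr, stepMin_mul_swap hr, stepMin, if_pos h2, stepMin,
          if_pos (by rw [hp, hr']; exact h4)] at this
    · have := h1.stepMax_le_stepMax hr
      rwa [stepMax_mul_swap hr, stepMax_mul_swap hr, stepMax, if_neg h2.not_gt, stepMax,
        if_neg (by rw [hp, hr']; exact (h2.trans h).not_gt)] at this

theorem bruhatLE_mul_swap {u : Perm (Fin n)} {p q : Fin n} (hpq : p < q) (h : u p < u q) :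
    BruhatLE u (u * swap p q) :=
  bruhatLE_mul_swap_aux (q - p - 1) u p q (by rw [Fin.lt_def] at hpq; omega) h

theorem swap_mul_eq_mul_swap_inv (u : Perm (Fin n)) (a b : Fin n) :
    swap a b * u = u * swap (u⁻¹ a) (u⁻¹ b) := by
  rw [Equiv.swap_apply_apply]; simp [mul_assoc]

theorem bruhatLE_swap_mul {u : Perm (Fin n)} {a b : Fin n} (hab : a < b) (h : u⁻¹ a < u⁻¹ b) :
    BruhatLE u (swap a b * u) := by
  rw [swap_mul_eq_mul_swap_inv]
  exact bruhatLE_mul_swap h (by simpa using hab)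

theorem length_lt_swap_mul {u : Perm (Fin n)} {a b : Fin n} (hab : a < b) (h : u⁻¹ a < u⁻¹ b) :
    length u < length (swap a b * u) := by
  rw [swap_mul_eq_mul_swap_inv]
  exact length_lt_mul_swap h (by simpa using hab)

/-- Exchanging an outer pair of an increasing triple is Bruhat-above exchanging an inner pair. -/
theorem bruhatLE_swap_mul_of_between {u : Perm (Fin n)} {a b c : Fin n} (hab : a < b)
    (hbc : b < c) (h : u⁻¹ a < u⁻¹ b) (h' : u⁻¹ b < u⁻¹ c) :
    BruhatLE (swap a b * u) (swap a c * u) ∧ BruhatLE (swap b c * u) (swap a c * u) := by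
  have hac := hab.trans hbc
  -- From `swap a b * u`, exchanging the values `a, c` and then `b, c` goes up both times and ends
  -- at `swap a c * u`; `e2` serves the other inner pair.
  have e1 : swap b c * swap a c * swap a b = swap a c := by
    ext x
    simp only [Perm.mul_apply, swap_apply_def]
    split_ifs <;> simp_all
  have e2 : swap a b * swap a c * swap b c = swap a c := by
    ext x
    simp only [Perm.mul_apply, swap_apply_def]
    split_ifs <;> simp_all
  constructor
  · rw [← e1, mul_assoc, mul_assoc]
    refine (bruhatLE_swap_mul hac ?_).trans (bruhatLE_swap_mul hbc ?_)
    · simpa [swap_apply_of_ne_of_ne hac.ne' hbc.ne'] using h'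
    · simpa [swap_apply_of_ne_of_ne hac.ne' hbc.ne', swap_apply_of_ne_of_ne hab.ne' hbc.ne]
        using h
  · rw [← e2, mul_assoc, mul_assoc]
    refine (bruhatLE_swap_mul hac ?_).trans (bruhatLE_swap_mul hab ?_)
    · simpa [swap_apply_of_ne_of_ne hab.ne hac.ne] using h
    · simpa [swap_apply_of_ne_of_ne hab.ne hac.ne, swap_apply_of_ne_of_ne hab.ne' hbc.ne]
        using h'

end Bruhat

/-! ### The point of a lower Bruhat interval nearest to a given permutation -/

section Nearest

variable {n : ℕ}

/-- For a descent `s` of `w`, the interval `[e, w]` is the union of `[e, w * s]` and its right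
translate by `s`. This drives the induction for `nearest`. -/
theorem BruhatLE.le_or_mul_swap_le {u w : Perm (Fin n)} {i j : Fin n} (hij : (j : ℕ) = i + 1)
    (hw : w j < w i) (h : BruhatLE u w) :
    BruhatLE u (w * swap i j) ∨ BruhatLE (u * swap i j) (w * swap i j) := by
  have h1 := h.stepMin_le_stepMin hij
  rw [stepMin.eq_def i j w, if_neg hw.not_gt, stepMin] at h1
  split_ifs at h1
  · exact Or.inl h1
  · exact Or.inr h1

theorem BruhatLE.mul_swap_le {u w : Perm (Fin n)} {i j : Fin n} (hij : (j : ℕ) = i + 1)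
    (hw : w j < w i) (h : BruhatLE u w) : BruhatLE (u * swap i j) w := by
  have h1 := h.stepMax_le_stepMax hij
  rw [stepMax.eq_def i j w, if_neg hw.not_gt, ← stepMax_mul_swap hij] at h1
  exact (le_stepMax hij _).trans h1

/-- Peel a descent `s` off `w`. If `u` is the solution for `w * s`, then whichever of `x⁻¹ * u` and
`x⁻¹ * u * s` is shorter gives the solution for `w`. -/
theorem exists_nearest (k : ℕ) : ∀ w x : Perm (Fin n), length w = k →
    ∃ u, BruhatLE u w ∧ inversions u ⊆ inversions x ∧
      ∀ v, BruhatLE v w → BruhatLE (x⁻¹ * u) (x⁻¹ * v) := by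
  induction k with
  | zero =>
    intro w x hw
    have h1 : w = 1 := by
      by_contra hne
      obtain ⟨i, j, hij, h⟩ := exists_descent hne
      have := length_mul_swap' hij h
      omega
    subst h1
    refine ⟨1, Relation.ReflTransGen.refl, by simp [inversions_one], fun v hv => ?_⟩
    rw [hv.eq_one]
    exact Relation.ReflTransGen.refl
  | succ k ih =>
    intro w x hw
    have hne : w ≠ 1 := by
      rintro rfl
      rw [length_one] at hw; omega
    obtain ⟨i, j, hij, h⟩ := exists_descent hne
    have hl := length_mul_swap' hij h
    have hww : BruhatLE (w * swap i j) w := bruhatLE_mul_swap_adjacent' hij h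
    have hlt : i < j := by rw [Fin.lt_def]; omega
    obtain ⟨u, hu, hinv, hmin⟩ := ih (w * swap i j) x (by omega)
    have key : ∀ v, BruhatLE v w → BruhatLE (stepMin i j (x⁻¹ * u)) (x⁻¹ * v) := by
      intro v hv
      rcases hv.le_or_mul_swap_le hij h with h' | h'
      · exact (stepMin_le hij _).trans (hmin v h')
      · have := (hmin _ h').stepMin_le_stepMin hij
        rw [← mul_assoc, stepMin_mul_swap hij] at this
        exact this.trans (stepMin_le hij _)
    by_cases hx : (x⁻¹ * u) i < (x⁻¹ * u) j
    · refine ⟨u, hu.trans hww, hinv, ?_⟩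
      rwa [stepMin, if_pos hx] at key
    · rw [stepMin, if_neg hx, mul_assoc] at key
      refine ⟨u * swap i j, (hu.trans hww).mul_swap_le hij h, ?_, key⟩
      -- Passing to `u * s` is forced only when `x` has `u j` before `u i`, so the inversion it
      -- creates belongs to `x`.
      have hx' : x⁻¹ (u j) < x⁻¹ (u i) :=
        lt_of_le_of_ne (not_lt.1 hx) (apply_ne_of_adjacent (x⁻¹ * u) hij).symm
      rcases (apply_ne_of_adjacent u hij).lt_or_gt with h1 | h1
      · rw [inversions_mul_swap hij h1]
        exact Finset.insert_subset (mem_inversions.2 ⟨h1, hx'⟩) hinv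
      · have := mem_inversions.1 (hinv (mem_inversions.2 ⟨h1, by simpa using hlt⟩))
        exact absurd this.2 hx'.not_gt

/-- The element `u` of `[e, w]` for which `x⁻¹ * u` is Bruhat-minimal. -/
noncomputable def nearest (w x : Perm (Fin n)) : Perm (Fin n) :=
  (exists_nearest (length w) w x rfl).choose

theorem nearest_le (w x : Perm (Fin n)) : BruhatLE (nearest w x) w :=
  (exists_nearest (length w) w x rfl).choose_spec.1

/-- `nearest` as a map to the 1-skeleton poset. -/
noncomputable def nearestP (w x : Perm (Fin n)) : P w := ⟨nearest w x, nearest_le w x⟩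

theorem nearest_weakLE (w x : Perm (Fin n)) : WeakLE (nearest w x) x :=
  weakLE_iff.2 (exists_nearest (length w) w x rfl).choose_spec.2.1

theorem inv_mul_nearest_le {w v : Perm (Fin n)} (x : Perm (Fin n)) (hv : BruhatLE v w) :
    BruhatLE (x⁻¹ * nearest w x) (x⁻¹ * v) :=
  (exists_nearest (length w) w x rfl).choose_spec.2.2 v hv

theorem nearest_of_le {w u : Perm (Fin n)} (hu : BruhatLE u w) : nearest w u = u := by
  have := inv_mul_nearest_le u hu
  rw [inv_mul_cancel] at this
  exact (inv_mul_eq_one.1 this.eq_one).symm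

end Nearest

/-! ### Linear functionals on the Bruhat interval polytope -/

section Functionals

variable {n : ℕ}

theorem vec_mul_swap (u : Perm (Fin n)) {p q : Fin n} (hpq : p ≠ q) :
    vec (u * swap p q) = vec u +
      ((q : ℝ) - (p : ℝ)) • (Pi.single (u p) (1 : ℝ) - Pi.single (u q) (1 : ℝ)) := by
  ext a
  obtain ⟨k, rfl⟩ := u.surjective a
  simp only [vec, mul_inv_rev, swap_inv, Perm.mul_apply, Pi.add_apply, Pi.smul_apply,
    Pi.sub_apply, Pi.single_apply, u.injective.eq_iff, smul_eq_mul]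
  by_cases hp : k = p
  · subst hp; simp [hpq]; ring
  by_cases hq : k = q
  · subst hq; simp [hp]; ring
  simp [hp, hq, swap_apply_of_ne_of_ne hp hq]

theorem dotProduct_vec_mul_swap (c : Fin n → ℝ) (u : Perm (Fin n)) {p q : Fin n} (hpq : p ≠ q) :
    c ⬝ᵥ vec (u * swap p q) = c ⬝ᵥ vec u - (c (u q) - c (u p)) * ((q : ℝ) - p) := by
  rw [vec_mul_swap u hpq, dotProduct_add, dotProduct_smul, dotProduct_sub,
    dotProduct_single_one, dotProduct_single_one, smul_eq_mul]
  ring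

theorem dotProduct_vec_mul_swap_le {c : Fin n → ℝ} {u : Perm (Fin n)} {p q : Fin n}
    (hpq : p < q) (h : c (u p) ≤ c (u q)) : c ⬝ᵥ vec (u * swap p q) ≤ c ⬝ᵥ vec u := by
  rw [dotProduct_vec_mul_swap c u hpq.ne]
  have : (0 : ℝ) ≤ (q : ℝ) - p := sub_nonneg.2 (by exact_mod_cast (Fin.lt_def.1 hpq).le)
  nlinarith [mul_nonneg (sub_nonneg.2 h) this]

theorem dotProduct_vec_mul_swap_lt {c : Fin n → ℝ} {u : Perm (Fin n)} {p q : Fin n}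
    (hpq : p < q) (h : c (u p) < c (u q)) : c ⬝ᵥ vec (u * swap p q) < c ⬝ᵥ vec u := by
  rw [dotProduct_vec_mul_swap c u hpq.ne]
  have : (0 : ℝ) < (q : ℝ) - p := sub_pos.2 (by exact_mod_cast Fin.lt_def.1 hpq)
  nlinarith [mul_pos (sub_pos.2 h) this]

/-- An upward step moves the larger value of `a` to an earlier position; on `C(x)` it carries the
larger coefficient of `c`, so the pairing drops. -/
theorem dotProduct_vec_le_of_bruhatLE {c : Fin n → ℝ} {x a b : Perm (Fin n)}
    (hc : c ∈ braidCone x) (h : BruhatLE a b) : c ⬝ᵥ vec (x * b) ≤ c ⬝ᵥ vec (x * a) := by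
  induction h with
  | refl => exact le_rfl
  | tail _ h ih =>
    obtain ⟨p, q, hpq, hlt, rfl, -⟩ := h.exists_swap
    rw [← mul_assoc]
    exact (dotProduct_vec_mul_swap_le hpq (by simpa using hc _ _ hlt.le)).trans ih

/-- An upward transposition step along which the functional `c` is constant. -/
def LevelStep (c : Fin n → ℝ) (x a b : Perm (Fin n)) : Prop :=
  ∃ p q : Fin n, p < q ∧ a p < a q ∧ b = a * swap p q ∧ c (x (a p)) = c (x (a q))

theorem reflTransGen_levelStep {c : Fin n → ℝ} {x a b : Perm (Fin n)}
    (hc : c ∈ braidCone x) (h : BruhatLE a b) (heq : c ⬝ᵥ vec (x * b) = c ⬝ᵥ vec (x * a)) :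
    Relation.ReflTransGen (LevelStep c x) a b := by
  induction h with
  | refl => exact Relation.ReflTransGen.refl
  | @tail b d hab h ih =>
    have h1 := dotProduct_vec_le_of_bruhatLE hc hab
    obtain ⟨p, q, hpq, hlt, rfl, -⟩ := h.exists_swap
    have h2 := dotProduct_vec_mul_swap_le (u := x * b) hpq (hc _ _ hlt.le)
    rw [← mul_assoc] at heq
    refine (ih (le_antisymm h1 (heq ▸ h2))).tail ⟨p, q, hpq, hlt, rfl, ?_⟩
    by_contra hne
    have h3 := dotProduct_vec_mul_swap_lt (u := x * b) hpq
      (lt_of_le_of_ne (hc _ _ hlt.le) hne)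
    linarith

theorem dotProduct_vec_le_nearest {c : Fin n → ℝ} {w x v : Perm (Fin n)}
    (hc : c ∈ braidCone x) (hv : BruhatLE v w) : c ⬝ᵥ vec v ≤ c ⬝ᵥ vec (nearest w x) := by
  simpa using dotProduct_vec_le_of_bruhatLE hc (inv_mul_nearest_le x hv)

theorem reflTransGen_levelStep_nearest {c : Fin n → ℝ} {w x v : Perm (Fin n)}
    (hc : c ∈ braidCone x) (hv : BruhatLE v w) (heq : c ⬝ᵥ vec v = c ⬝ᵥ vec (nearest w x)) :
    Relation.ReflTransGen (LevelStep c x) (x⁻¹ * nearest w x) (x⁻¹ * v) :=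
  reflTransGen_levelStep hc (inv_mul_nearest_le x hv) (by simpa using heq)

theorem vec_mem_Q {w u : Perm (Fin n)} (h : BruhatLE u w) : vec u ∈ Q w :=
  subset_convexHull ℝ _ ⟨u, h, rfl⟩

theorem dotProduct_le_of_mem_Q {w : Perm (Fin n)} {c : Fin n → ℝ} {M : ℝ}
    (h : ∀ u, BruhatLE u w → c ⬝ᵥ vec u ≤ M) {p : Fin n → ℝ} (hp : p ∈ Q w) : c ⬝ᵥ p ≤ M := by
  have hconv : Convex ℝ {p : Fin n → ℝ | c ⬝ᵥ p ≤ M} :=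
    convex_halfSpace_le ⟨fun x y => dotProduct_add c x y, fun a x => dotProduct_smul a c x⟩ M
  refine convexHull_min ?_ hconv hp
  rintro _ ⟨u, hu, rfl⟩
  exact h u hu

theorem vec_mem_braidCone (x : Perm (Fin n)) : vec x ∈ braidCone x := fun i j hij => by
  simpa [vec] using hij

theorem braidCone_subset_normalCone_iff {w x u : Perm (Fin n)} (hu : BruhatLE u w) :
    braidCone x ⊆ normalCone w u ↔ nearest w x = u := by
  constructor
  · intro h
    have h1 := h (vec_mem_braidCone x) _ (vec_mem_Q (nearest_le w x))
    have h2 := dotProduct_vec_le_nearest (vec_mem_braidCone x) hu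
    have h3 := reflTransGen_levelStep_nearest (vec_mem_braidCone x) hu (le_antisymm h2 h1)
    -- `vec x` is interior to `C(x)`: its coordinates are distinct, so it admits no level step.
    rcases Relation.ReflTransGen.cases_head h3 with e | ⟨_, ⟨p, q, -, hlt, -, he⟩, -⟩
    · exact mul_left_cancel e
    · refine absurd he (ne_of_lt ?_)
      simpa [vec] using hlt
  · rintro rfl c hc p hp
    exact dotProduct_le_of_mem_Q (fun v hv => dotProduct_vec_le_nearest hc hv) hp

theorem theta_iff {w x y : Perm (Fin n)} : Theta w x y ↔ nearest w x = nearest w y := by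
  constructor
  · rintro ⟨u, hu, hx, hy⟩
    rw [(braidCone_subset_normalCone_iff hu).1 hx, (braidCone_subset_normalCone_iff hu).1 hy]
  · intro h
    exact ⟨nearest w x, nearest_le w x, (braidCone_subset_normalCone_iff (nearest_le w x)).2 rfl,
      (braidCone_subset_normalCone_iff (nearest_le w x)).2 h.symm⟩

end Functionals

/-! ### Edges from weak order covers -/

section Edges

variable {n : ℕ}

/-- A functional in the relative interior of the wall between `C(x)` and `C(x * swap i j)`. -/
noncomputable def wallPoint (x : Perm (Fin n)) (i j : Fin n) : Fin n → ℝ := fun a =>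
  if x⁻¹ a = j then (i : ℝ) else ((x⁻¹ a : Fin n) : ℝ)

theorem wallPoint_apply (x : Perm (Fin n)) (i j k : Fin n) :
    wallPoint x i j (x k) = if k = j then (i : ℝ) else (k : ℝ) := by
  simp [wallPoint]

theorem wallPoint_mem_braidCone {x : Perm (Fin n)} {i j : Fin n} (hij : (j : ℕ) = i + 1) :
    wallPoint x i j ∈ braidCone x := by
  intro p q hpq
  rw [wallPoint_apply, wallPoint_apply]
  rw [Fin.le_def] at hpq
  split_ifs with h1 h2 h2 <;> simp only [Nat.cast_le, Fin.ext_iff] at * <;> omega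

theorem wallPoint_mem_braidCone_mul_swap {x : Perm (Fin n)} {i j : Fin n}
    (hij : (j : ℕ) = i + 1) : wallPoint x i j ∈ braidCone (x * swap i j) := by
  intro p q hpq
  have key : ∀ k, wallPoint x i j ((x * swap i j) k) = wallPoint x i j (x k) := by
    intro k
    have hne : i ≠ j := by rintro rfl; omega
    rw [Perm.mul_apply, wallPoint_apply, wallPoint_apply]
    rcases eq_or_ne k i with rfl | hi
    · simp [hne]
    rcases eq_or_ne k j with rfl | hj
    · simp [hne]
    rw [swap_apply_of_ne_of_ne hi hj]
  rw [key, key]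
  exact wallPoint_mem_braidCone hij p q hpq

theorem eq_of_wallPoint_eq {x : Perm (Fin n)} {i j p q : Fin n} (hij : (j : ℕ) = i + 1)
    (hpq : p < q) (h : wallPoint x i j (x p) = wallPoint x i j (x q)) : p = i ∧ q = j := by
  rw [wallPoint_apply, wallPoint_apply] at h
  rw [Fin.lt_def] at hpq
  split_ifs at h <;> simp only [Nat.cast_inj, Fin.ext_iff] at * <;> omega

/-- The wall point has just one tie, so a level step can only exchange the values `i` and `j` of
`x⁻¹ * nearest w x`; a second such step would go back down. -/
theorem eq_or_eq_of_wallPoint_max {w x v : Perm (Fin n)} {i j : Fin n} (hij : (j : ℕ) = i + 1)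
    (hv : BruhatLE v w)
    (heq : wallPoint x i j ⬝ᵥ vec v = wallPoint x i j ⬝ᵥ vec (nearest w x)) :
    v = nearest w x ∨ (v = swap (x i) (x j) * nearest w x ∧
      (nearest w x)⁻¹ (x i) < (nearest w x)⁻¹ (x j)) := by
  have h := reflTransGen_levelStep_nearest (wallPoint_mem_braidCone hij) hv heq
  have key : ∀ a b : Perm (Fin n), Relation.ReflTransGen (LevelStep (wallPoint x i j) x) a b →
      b = a ∨ (b = swap i j * a ∧ a⁻¹ i < a⁻¹ j) := by
    intro a b h
    induction h with
    | refl => exact Or.inl rfl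
    | @tail b d _ h ih =>
      obtain ⟨p, q, hpq, hlt, rfl, he⟩ := h
      obtain ⟨hp, hq⟩ := eq_of_wallPoint_eq hij hlt he
      have hp' : p = b⁻¹ i := by rw [← hp]; simp
      have hq' : q = b⁻¹ j := by rw [← hq]; simp
      subst hp' hq'
      rcases ih with rfl | ⟨rfl, h2⟩
      · exact Or.inr ⟨(swap_mul_eq_mul_swap_inv _ _ _).symm, hpq⟩
      · rw [mul_inv_rev, Perm.mul_apply, Perm.mul_apply, swap_inv, swap_apply_left,
          swap_apply_right] at hpq
        exact absurd h2 hpq.not_gt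
  rcases key _ _ h with e | ⟨e, h1⟩
  · exact Or.inl (mul_left_cancel e)
  · refine Or.inr ⟨?_, by simpa using h1⟩
    have : v = x * (swap i j * (x⁻¹ * nearest w x)) := by rw [← e]; simp
    rw [this, Equiv.swap_apply_apply]
    simp [mul_assoc]

theorem wallPoint_nearest_eq (w x : Perm (Fin n)) {i j : Fin n} (hij : (j : ℕ) = i + 1) :
    wallPoint x i j ⬝ᵥ vec (nearest w (x * swap i j)) =
      wallPoint x i j ⬝ᵥ vec (nearest w x) :=
  le_antisymm (dotProduct_vec_le_nearest (wallPoint_mem_braidCone hij) (nearest_le _ _))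
    (dotProduct_vec_le_nearest (wallPoint_mem_braidCone_mul_swap hij) (nearest_le _ _))

theorem nearest_mul_swap (w x : Perm (Fin n)) {i j : Fin n} (hij : (j : ℕ) = i + 1) :
    nearest w (x * swap i j) = nearest w x ∨
      (nearest w (x * swap i j) = swap (x i) (x j) * nearest w x ∧
        (nearest w x)⁻¹ (x i) < (nearest w x)⁻¹ (x j)) :=
  eq_or_eq_of_wallPoint_max hij (nearest_le _ _) (wallPoint_nearest_eq w x hij)

theorem isExposed_segment_of_maximizers {w u v : Perm (Fin n)} {c : Fin n → ℝ}
    (hu : BruhatLE u w) (hv : BruhatLE v w) (hmax : ∀ p, BruhatLE p w → c ⬝ᵥ vec p ≤ c ⬝ᵥ vec u)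
    (huv : c ⬝ᵥ vec v = c ⬝ᵥ vec u)
    (heq : ∀ p, BruhatLE p w → c ⬝ᵥ vec p = c ⬝ᵥ vec u → p = u ∨ p = v) :
    IsExposed ℝ (Q w) (segment ℝ (vec u) (vec v)) := by
  intro _
  let l : (Fin n → ℝ) →ₗ[ℝ] ℝ :=
    { toFun := fun p => c ⬝ᵥ p
      map_add' := dotProduct_add c
      map_smul' := fun a x => dotProduct_smul a c x }
  have hl : ∀ p, l.toContinuousLinearMap p = c ⬝ᵥ p := fun _ => rfl
  have hseg : ∀ p ∈ segment ℝ (vec u) (vec v), c ⬝ᵥ p = c ⬝ᵥ vec u := by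
    rintro _ ⟨a, b, -, -, hab, rfl⟩
    rw [dotProduct_add, dotProduct_smul, dotProduct_smul, huv, ← add_smul, hab, one_smul]
  refine ⟨l.toContinuousLinearMap, Set.Subset.antisymm ?_ ?_⟩
  · intro p hp
    refine ⟨(convex_convexHull ℝ _).segment_subset (vec_mem_Q hu) (vec_mem_Q hv) hp, ?_⟩
    intro y hy
    rw [hl, hl, hseg p hp]
    exact dotProduct_le_of_mem_Q hmax hy
  · rintro p ⟨hp, hmaxp⟩
    have hge := hmaxp _ (vec_mem_Q hu)
    rw [hl, hl] at hge
    -- An open half-space together with a segment in its boundary is convex. It contains all the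
    -- points `vec p`, hence `Q w`, so the maximizers lie on the segment.
    have hconv : Convex ℝ ({p | c ⬝ᵥ p < c ⬝ᵥ vec u} ∪ segment ℝ (vec u) (vec v)) := by
      rw [convex_iff_forall_pos]
      intro x hx y hy a b ha hb hab
      have hle : ∀ z ∈ {p | c ⬝ᵥ p < c ⬝ᵥ vec u} ∪ segment ℝ (vec u) (vec v),
          c ⬝ᵥ z ≤ c ⬝ᵥ vec u := by
        rintro z (hz | hz)
        · exact hz.le
        · exact (hseg z hz).le
      have hlt : ∀ s t : ℝ, s ≤ c ⬝ᵥ vec u → t ≤ c ⬝ᵥ vec u → s < c ⬝ᵥ vec u ∨ t < c ⬝ᵥ vec u →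
          a * s + b * t < c ⬝ᵥ vec u := by
        intro s t hs ht hst
        have e : c ⬝ᵥ vec u = a * (c ⬝ᵥ vec u) + b * (c ⬝ᵥ vec u) := by
          rw [← add_mul, hab, one_mul]
        rw [e]
        rcases hst with h | h
        · exact add_lt_add_of_lt_of_le (mul_lt_mul_of_pos_left h ha)
            (mul_le_mul_of_nonneg_left ht hb.le)
        · exact add_lt_add_of_le_of_lt (mul_le_mul_of_nonneg_left hs ha.le)
            (mul_lt_mul_of_pos_left h hb)
      by_cases hst : c ⬝ᵥ x < c ⬝ᵥ vec u ∨ c ⬝ᵥ y < c ⬝ᵥ vec u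
      · left
        simpa [dotProduct_add, dotProduct_smul] using hlt _ _ (hle x hx) (hle y hy) hst
      · push Not at hst
        right
        exact convex_segment _ _ (hx.resolve_left fun h => h.not_ge hst.1)
          (hy.resolve_left fun h => h.not_ge hst.2) ha.le hb.le hab
    have hsub : Q w ⊆ {p | c ⬝ᵥ p < c ⬝ᵥ vec u} ∪ segment ℝ (vec u) (vec v) := by
      refine convexHull_min ?_ hconv
      rintro _ ⟨p, hp, rfl⟩
      rcases (hmax p hp).lt_or_eq with h | h
      · exact Or.inl h
      · right
        rcases heq p hp h with rfl | rfl
        · exact left_mem_segment _ _ _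
        · exact right_mem_segment _ _ _
    exact (hsub hp).resolve_left fun h => h.not_ge hge

theorem vec_injective : Function.Injective (vec (n := n)) := by
  intro u v h
  rw [← inv_inj]
  ext i
  simpa [vec] using congrFun h i

theorem upEdge_of_nearest_ne {w x : Perm (Fin n)} {i j : Fin n} (hij : (j : ℕ) = i + 1)
    (hlt : x i < x j) (hne : nearest w (x * swap i j) ≠ nearest w x) :
    UpEdge w (nearestP w x) (nearestP w (x * swap i j)) := by
  obtain ⟨e, hpos⟩ := (nearest_mul_swap w x hij).resolve_left hne
  refine ⟨⟨fun h => hne (vec_injective h).symm, ?_⟩, ?_⟩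
  · refine isExposed_segment_of_maximizers (nearest_le w x) (nearest_le w _)
      (fun p hp => dotProduct_vec_le_nearest (wallPoint_mem_braidCone hij) hp)
      (wallPoint_nearest_eq w x hij) fun p hp hpe => ?_
    rcases eq_or_eq_of_wallPoint_max hij hp hpe with h | ⟨h, -⟩
    · exact Or.inl h
    · exact Or.inr (h.trans e.symm)
  · simp only [nearestP, e]
    exact length_lt_swap_mul hlt hpos

theorem nearest_le_nearest {x y : Perm (Fin n)} (w : Perm (Fin n)) (h : WeakLE x y) :
    nearestP w x ≤ nearestP w y := by
  induction h with
  | refl => exact le_rfl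
  | @tail y z _ h ih =>
    obtain ⟨i, j, hij, hlt, rfl⟩ := weakCover_iff.1 h
    refine ih.trans ?_
    by_cases hne : nearest w (y * swap i j) = nearest w y
    · exact le_of_eq (Subtype.ext hne.symm)
    · exact Relation.ReflTransGen.single (upEdge_of_nearest_ne hij hlt hne)

end Edges

/-! ### Classes as sets of linear extensions -/

section Classes

variable {n : ℕ}

/-- Membership in a class becomes a set of conditions on the relative order of pairs of values:
those inverted in `u`, and those whose exchange moves `u` up within `[e, w]`. -/
theorem nearest_eq_iff {w u x : Perm (Fin n)} (hu : BruhatLE u w) :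
    nearest w x = u ↔ inversions u ⊆ inversions x ∧
      ∀ a b, a < b → u⁻¹ a < u⁻¹ b → BruhatLE (swap a b * u) w → x⁻¹ a < x⁻¹ b := by
  constructor
  · rintro rfl
    refine ⟨(nearest_weakLE w x).inversions_subset, fun a b hab hpos hle => ?_⟩
    by_contra hx
    have h1 : x⁻¹ b < x⁻¹ a := lt_of_le_of_ne (not_lt.1 hx) (x⁻¹.injective.ne hab.ne')
    have h2 := dotProduct_vec_le_nearest (vec_mem_braidCone x) hle
    rw [swap_mul_eq_mul_swap_inv, dotProduct_vec_mul_swap _ _ hpos.ne] at h2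
    have h3 : ((x⁻¹ b : Fin n) : ℝ) < ((x⁻¹ a : Fin n) : ℝ) := by
      exact_mod_cast Fin.lt_def.1 h1
    have h4 : (((nearest w x)⁻¹ a : Fin n) : ℝ) < (((nearest w x)⁻¹ b : Fin n) : ℝ) := by
      exact_mod_cast Fin.lt_def.1 hpos
    have h5 : ∀ a, nearest w x ((nearest w x)⁻¹ a) = a := fun a => by simp
    rw [h5, h5] at h2
    simp only [vec] at h2
    nlinarith [mul_pos (sub_pos.2 h3) (sub_pos.2 h4)]
  · rintro ⟨hinv, hcon⟩
    -- Climb from `u` to `x` in weak order. A step that changed `nearest` would invert a pair that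
    -- `hcon` keeps in natural order in `x`.
    have key : ∀ y, WeakLE u y → WeakLE y x → nearest w y = u := by
      intro y huy
      induction huy with
      | refl => exact fun _ => nearest_of_le hu
      | @tail y z _ h ih =>
        intro hzx
        have hy := ih ((Relation.ReflTransGen.single h).trans hzx)
        obtain ⟨i, j, hij, hlt, rfl⟩ := weakCover_iff.1 h
        rcases nearest_mul_swap w y hij with e | ⟨e, hpos⟩
        · rw [e, hy]
        · rw [hy] at e hpos
          have h1 := hcon _ _ hlt hpos (e ▸ nearest_le w _)
          have h2 := hzx.inversions_subset
          rw [inversions_mul_swap hij hlt] at h2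
          exact absurd h1 (mem_inversions.1 (h2 (Finset.mem_insert_self _ _))).2.not_gt
    exact key x (weakLE_iff.2 hinv) Relation.ReflTransGen.refl

/-- The relations (`a` precedes `b`) that cut out the class of `u`. -/
def Precedes (w u : Perm (Fin n)) (a b : Fin n) : Prop :=
  u⁻¹ a < u⁻¹ b ∧ (b < a ∨ a < b ∧ BruhatLE (swap a b * u) w)

/-- The strict partial order whose linear extensions form the class of `u`. -/
abbrev ClassLT (w u : Perm (Fin n)) : Fin n → Fin n → Prop := Relation.TransGen (Precedes w u)

theorem nearest_eq_iff_precedes {w u x : Perm (Fin n)} (hu : BruhatLE u w) :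
    nearest w x = u ↔ ∀ a b, Precedes w u a b → x⁻¹ a < x⁻¹ b := by
  rw [nearest_eq_iff hu]
  constructor
  · rintro ⟨h1, h2⟩ a b ⟨hpos, hab | ⟨hab, hle⟩⟩
    · exact (mem_inversions.1 (h1 (mem_inversions.2 ⟨hab, hpos⟩))).2
    · exact h2 a b hab hpos hle
  · intro h
    refine ⟨fun ⟨a, b⟩ hab => ?_, fun a b hab hpos hle => h a b ⟨hpos, Or.inr ⟨hab, hle⟩⟩⟩
    rw [mem_inversions] at hab ⊢
    exact ⟨hab.1, h b a ⟨hab.2, Or.inl hab.1⟩⟩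

theorem ClassLT.lt {w u x : Perm (Fin n)} {a b : Fin n} (hu : BruhatLE u w)
    (hx : nearest w x = u) (h : ClassLT w u a b) : x⁻¹ a < x⁻¹ b := by
  rw [nearest_eq_iff_precedes hu] at hx
  induction h with
  | single h => exact hx _ _ h
  | tail _ h ih => exact ih.trans (hx _ _ h)

/-- Locate `m` in `u`. Before `l` or after `r` it forms an inversion. In between, exchanging `l, m`
or `m, r` stays Bruhat-below exchanging `l, r`, hence below `w`. -/
theorem Precedes.trichotomy {w u : Perm (Fin n)} {l m r : Fin n} (h : Precedes w u l r)
    (hlm : l < m) (hmr : m < r) : (ClassLT w u l m ∧ ClassLT w u m r) ∨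
      ClassLT w u m l ∨ ClassLT w u r m := by
  obtain ⟨hpos, h | ⟨-, hle⟩⟩ := h
  · exact absurd h (hlm.trans hmr).not_gt
  rcases (u⁻¹.injective.ne hlm.ne).lt_or_gt with h1 | h1
  · rcases (u⁻¹.injective.ne hmr.ne).lt_or_gt with h2 | h2
    · obtain ⟨h3, h4⟩ := bruhatLE_swap_mul_of_between hlm hmr h1 h2
      exact Or.inl ⟨.single ⟨h1, Or.inr ⟨hlm, h3.trans hle⟩⟩,
        .single ⟨h2, Or.inr ⟨hmr, h4.trans hle⟩⟩⟩
    · exact Or.inr (Or.inr (.single ⟨h2, Or.inl hmr⟩))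
  · exact Or.inr (Or.inl (.single ⟨h1, Or.inl hlm⟩))

/-- A chain from below `m` to above `m` passes through `m` or has a step across `m`. -/
theorem ClassLT.crossing {w u : Perm (Fin n)} {a m b : Fin n} (h : ClassLT w u a b)
    (ham : a < m) (hmb : m < b) : (ClassLT w u a m ∧ ClassLT w u m b) ∨
      ∃ l r, Relation.ReflTransGen (Precedes w u) a l ∧ Precedes w u l r ∧ l < m ∧ m < r ∧
        Relation.ReflTransGen (Precedes w u) r b := by
  induction h with
  | single h => exact Or.inr ⟨_, _, .refl, h, ham, hmb, .refl⟩
  | @tail y b hy h ih =>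
    rcases lt_trichotomy y m with hym | rfl | hym
    · exact Or.inr ⟨y, b, hy.to_reflTransGen, h, hym, hmb, .refl⟩
    · exact Or.inl ⟨hy, .single h⟩
    · rcases ih hym with ⟨h1, h2⟩ | ⟨l, r, h1, h2, h3, h4, h5⟩
      · exact Or.inl ⟨h1, h2.tail h⟩
      · exact Or.inr ⟨l, r, h1, h2, h3, h4, h5.tail h⟩

theorem ClassLT.or_of_between {w u : Perm (Fin n)} {a m b : Fin n} (h : ClassLT w u a b)
    (ham : a < m) (hmb : m < b) : ClassLT w u a m ∨ ClassLT w u m b := by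
  rcases h.crossing ham hmb with h | ⟨l, r, h1, h2, h3, h4, h5⟩
  · exact Or.inl h.1
  · rcases h2.trichotomy h3 h4 with h | h | h
    · exact Or.inl (.trans_right h1 h.1)
    · exact Or.inr (.trans_left (h.tail h2) h5)
    · exact Or.inl (.trans_right h1 (.trans (.single h2) h))

/-- The class of `u` has a weak order maximum, in which only the forced pairs are in natural
order. -/
theorem exists_classTop {w u : Perm (Fin n)} (hu : BruhatLE u w) :
    ∃ z, nearest w z = u ∧ (∀ x, nearest w x = u → WeakLE x z) ∧
      ∀ a b, a < b → z⁻¹ a < z⁻¹ b → ClassLT w u a b := by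
  have hacy : ∀ a b, ClassLT w u a b → u⁻¹ a < u⁻¹ b := fun a b h =>
    h.lt hu (nearest_of_le hu)
  -- Keep the forced natural pairs and reverse all others; `or_of_between` makes this transitive.
  obtain ⟨z, hz⟩ := exists_perm_of_strictTotalOrder
    (fun a b => (a < b ∧ ClassLT w u a b) ∨ (b < a ∧ ¬ClassLT w u b a))
    (by simp)
    (by
      rintro a b c (⟨h1, h2⟩ | ⟨h1, h2⟩) (⟨h3, h4⟩ | ⟨h3, h4⟩)
      · exact Or.inl ⟨h1.trans h3, h2.trans h4⟩
      · rcases lt_trichotomy a c with h | rfl | h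
        · exact Or.inl ⟨h, (h2.or_of_between h h3).resolve_right h4⟩
        · exact absurd h2 h4
        · exact Or.inr ⟨h, fun h5 => h4 (h5.trans h2)⟩
      · rcases lt_trichotomy a c with h | rfl | h
        · exact Or.inl ⟨h, (h4.or_of_between h1 h).resolve_left h2⟩
        · exact absurd h4 h2
        · exact Or.inr ⟨h, fun h5 => h2 (h4.trans h5)⟩
      · exact Or.inr ⟨h3.trans h1, fun h5 => (h5.or_of_between h3 h1).elim h4 h2⟩)
    (by
      intro a b hne
      rcases hne.lt_or_gt with h | h
      · by_cases hc : ClassLT w u a b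
        · exact Or.inl (Or.inl ⟨h, hc⟩)
        · exact Or.inr (Or.inr ⟨h, hc⟩)
      · by_cases hc : ClassLT w u b a
        · exact Or.inr (Or.inl ⟨h, hc⟩)
        · exact Or.inl (Or.inr ⟨h, hc⟩))
  refine ⟨z, (nearest_eq_iff_precedes hu).2 fun a b hab => (hz a b).2 ?_, fun x hx => ?_,
    fun a b hab h => ?_⟩
  · obtain ⟨-, h | ⟨h, -⟩⟩ := id hab
    · exact Or.inr ⟨h, fun h' => (hacy _ _ h').not_gt hab.1⟩
    · exact Or.inl ⟨h, .single hab⟩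
  · rw [weakLE_iff]
    rintro ⟨a, b⟩ hab
    rw [mem_inversions] at hab ⊢
    exact ⟨hab.1, (hz b a).2 (Or.inr ⟨hab.1, fun h => (h.lt hu hx).not_gt hab.2⟩)⟩
  · rcases (hz a b).1 h with h | h
    · exact h.2
    · exact absurd hab h.1.not_gt

theorem classTop_le_classTop_of_cover {w x z z' : Perm (Fin n)} {i j : Fin n}
    (hij : (j : ℕ) = i + 1) (hlt : x i < x j)
    (hz : nearest w z = nearest w x) (hmax : ∀ y, nearest w y = nearest w x → WeakLE y z)
    (hasc : ∀ a b, a < b → z⁻¹ a < z⁻¹ b → ClassLT w (nearest w x) a b)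
    (hmax' : ∀ y, nearest w y = nearest w (x * swap i j) → WeakLE y z') : WeakLE z z' := by
  by_cases hne : nearest w (x * swap i j) = nearest w x
  · exact hmax' z (hz.trans hne.symm)
  obtain ⟨e, hpos⟩ := (nearest_mul_swap w x hij).resolve_left hne
  have hu := nearest_le w x
  have hab : Precedes w (nearest w x) (x i) (x j) :=
    ⟨hpos, Or.inr ⟨hlt, e ▸ nearest_le w _⟩⟩
  generalize ha : x i = a at *
  generalize hb : x j = b at *
  -- `a` and `b` are adjacent in the linear extension `x`, so nothing is forced between them.
  have hcov : ∀ m, ClassLT w (nearest w x) a m → ClassLT w (nearest w x) m b → False := by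
    intro m h1 h2
    have h3 := h1.lt hu rfl
    have h4 := h2.lt hu rfl
    rw [← ha] at h3
    rw [← hb] at h4
    simp only [Perm.inv_def, symm_apply_apply, Fin.lt_def] at h3 h4
    omega
  have hzab : z⁻¹ a < z⁻¹ b := ClassLT.lt hu hz (.single hab)
  -- Were `m` next after `a` and before `b` in `z`, its natural-order pairs with `a` and `b` would
  -- be forced. Then `m` is forced between them, or a forced chain crosses `a` or `b`; each outcome
  -- contradicts `hcov` or the order of `z`.
  have hadj : ((z⁻¹ b : Fin n) : ℕ) = (z⁻¹ a : Fin n) + 1 := by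
    by_contra hc
    let k : Fin n := ⟨(z⁻¹ a : Fin n) + 1, by rw [Fin.lt_def] at hzab; omega⟩
    have hk : (k : ℕ) = (z⁻¹ a : Fin n) + 1 := rfl
    obtain ⟨m, hm⟩ := z⁻¹.surjective k
    have ham : z⁻¹ a < z⁻¹ m := by rw [hm, Fin.lt_def]; omega
    have hmb : z⁻¹ m < z⁻¹ b := by
      rw [hm]; rw [Fin.lt_def] at hzab ⊢; omega
    have hma : a ≠ m := fun h => by simp [h] at ham
    have hmb' : m ≠ b := fun h => by simp [h] at hmb
    rcases hma.lt_or_gt with h1 | h1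
    · have h2 := hasc a m h1 ham
      rcases hmb'.lt_or_gt with h3 | h3
      · exact hcov m h2 (hasc m b h3 hmb)
      · have hnot : ¬ClassLT w (nearest w x) b m := fun h => (h.lt hu hz).not_gt hmb
        rcases h2.crossing hlt h3 with h | ⟨l, r, g1, g2, g3, g4, g5⟩
        · exact hnot h.2
        · rcases g2.trichotomy g3 g4 with h | h | h
          · exact hnot (.trans_left h.2 g5)
          · exact hnot (.trans_left (h.tail g2) g5)
          · exact hcov r (.trans_right g1 (.single g2)) h
    · have hnot : ¬ClassLT w (nearest w x) m a := fun h => (h.lt hu hz).not_gt ham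
      have h2 := hasc m b (h1.trans hlt) hmb
      rcases h2.crossing h1 hlt with h | ⟨l, r, g1, g2, g3, g4, g5⟩
      · exact hnot h.1
      · rcases g2.trichotomy g3 g4 with h | h | h
        · exact hnot (.trans_right g1 h.1)
        · exact hcov l h (.trans_left (.single g2) g5)
        · exact hnot (.trans_right g1 (.trans (.single g2) h))
  have hza : z (z⁻¹ a) = a := by simp
  have hzb : z (z⁻¹ b) = b := by simp
  have hcover : WeakLE z (z * swap (z⁻¹ a) (z⁻¹ b)) :=
    .single (weakCover_iff.2 ⟨_, _, hadj, by rw [hza, hzb]; exact hlt, rfl⟩)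
  refine hcover.trans (hmax' _ ?_)
  -- The step up from `z` must leave the class, since `z` is its maximum.
  rcases nearest_mul_swap w z hadj with h | ⟨h, -⟩
  · have h1 := (hmax _ (h.trans hz)).antisymm hcover
    rw [mul_eq_left, swap_eq_one_iff] at h1
    exact absurd h1 hzab.ne
  · rw [h, hz, hza, hzb, e]

end Classes

/-! ### Weak order relations from edges -/

section EdgeLift

variable {n : ℕ}

theorem vec_dotProduct_self (u : Perm (Fin n)) :
    vec u ⬝ᵥ vec u = ∑ k : Fin n, ((k : ℝ) + 1) * ((k : ℝ) + 1) :=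
  Equiv.sum_comp u⁻¹ fun k : Fin n => ((k : ℝ) + 1) * ((k : ℝ) + 1)

/-- All `vec u` lie on one sphere, so `vec u` as a functional is maximized among them only at
itself. -/
theorem eq_of_le_vec_dotProduct {u v : Perm (Fin n)} (h : vec u ⬝ᵥ vec u ≤ vec u ⬝ᵥ vec v) :
    v = u := by
  apply vec_injective
  rw [← sub_eq_zero, ← dotProduct_self_eq_zero]
  refine le_antisymm ?_ (Finset.sum_nonneg fun i _ => mul_self_nonneg _)
  rw [sub_dotProduct, dotProduct_sub, dotProduct_sub, dotProduct_comm (vec v) (vec u),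
    vec_dotProduct_self v, ← vec_dotProduct_self u]
  linarith

theorem eq_or_eq_of_vec_mem_segment {u v p : Perm (Fin n)}
    (h : vec p ∈ segment ℝ (vec u) (vec v)) : p = u ∨ p = v := by
  by_contra! hc
  have h1 : vec p ⬝ᵥ vec u < vec p ⬝ᵥ vec p :=
    lt_of_not_ge fun h => hc.1 (eq_of_le_vec_dotProduct h).symm
  have h2 : vec p ⬝ᵥ vec v < vec p ⬝ᵥ vec p :=
    lt_of_not_ge fun h => hc.2 (eq_of_le_vec_dotProduct h).symm
  obtain ⟨a, b, ha, hb, hab, e⟩ := h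
  have h3 : vec p ⬝ᵥ vec p = a * (vec p ⬝ᵥ vec u) + b * (vec p ⬝ᵥ vec v) := by
    nth_rewrite 2 [← e]
    rw [dotProduct_add, dotProduct_smul, dotProduct_smul, smul_eq_mul, smul_eq_mul]
  rcases ha.eq_or_lt with rfl | ha
  · obtain rfl : b = 1 := by linarith
    linarith
  · have hb' : b = 1 - a := by linarith
    subst hb'
    nlinarith [mul_pos ha (sub_pos.2 h1), mul_nonneg hb (sub_pos.2 h2).le]

/-- Sorting the values by `c`, with ties broken by the permutation `g`. -/
theorem exists_sort (c : Fin n → ℝ) (g : Perm (Fin n)) :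
    ∃ x : Perm (Fin n), ∀ a b, x⁻¹ a < x⁻¹ b ↔ c a < c b ∨ (c a = c b ∧ g a < g b) := by
  apply exists_perm_of_strictTotalOrder
  · simp
  · rintro a b d (h1 | ⟨h1, h2⟩) (h3 | ⟨h3, h4⟩)
    · exact Or.inl (h1.trans h3)
    · exact Or.inl (h3 ▸ h1)
    · exact Or.inl (h1 ▸ h3)
    · exact Or.inr ⟨h1.trans h3, h2.trans h4⟩
  · intro a b hne
    rcases lt_trichotomy (c a) (c b) with h | h | h
    · exact Or.inl (Or.inl h)
    · rcases (g.injective.ne hne).lt_or_gt with h' | h'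
      · exact Or.inl (Or.inr ⟨h, h'⟩)
      · exact Or.inr (Or.inr ⟨h.symm, h'⟩)
    · exact Or.inr (Or.inl h)

theorem mem_braidCone_of_sort {c : Fin n → ℝ} {g x : Perm (Fin n)}
    (hx : ∀ a b, x⁻¹ a < x⁻¹ b ↔ c a < c b ∨ (c a = c b ∧ g a < g b)) : c ∈ braidCone x := by
  intro i j hij
  rcases hij.eq_or_lt with rfl | h
  · exact le_rfl
  · rcases (hx (x i) (x j)).1 (by simpa using h) with h | h
    · exact h.le
    · exact h.1.le

/-- Breaking ties by `u` acts like perturbing `c` towards `vec u`: level steps from `nearest w x` to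
`u` exchange only tied values and cannot increase the pairing with `vec u`, which is already largest
at `u`. -/
theorem nearest_sort {w u x : Perm (Fin n)} {c : Fin n → ℝ} (hu : BruhatLE u w)
    (hmax : ∀ p, BruhatLE p w → c ⬝ᵥ vec p ≤ c ⬝ᵥ vec u)
    (hx : ∀ a b, x⁻¹ a < x⁻¹ b ↔ c a < c b ∨ (c a = c b ∧ u⁻¹ a < u⁻¹ b)) :
    nearest w x = u := by
  have hc := mem_braidCone_of_sort hx
  have h := reflTransGen_levelStep_nearest hc hu
    (le_antisymm (dotProduct_vec_le_nearest hc hu) (hmax _ (nearest_le w x)))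
  have key : ∀ a b : Perm (Fin n), Relation.ReflTransGen (LevelStep c x) a b →
      vec u ⬝ᵥ vec (x * b) ≤ vec u ⬝ᵥ vec (x * a) := by
    intro a b h
    induction h with
    | refl => exact le_rfl
    | tail _ h ih =>
      obtain ⟨p, q, hpq, hlt, rfl, he⟩ := h
      refine le_trans ?_ ih
      rw [← mul_assoc]
      refine dotProduct_vec_mul_swap_le hpq ?_
      have h1 := (hx _ _).1 (show x⁻¹ (x _) < x⁻¹ (x _) by simpa using hlt)
      rcases h1 with h1 | h1
      · exact absurd he h1.ne
      · simpa [vec] using h1.2.le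
  exact eq_of_le_vec_dotProduct (by simpa using key _ _ h)

theorem length_le_of_le {w : Perm (Fin n)} {u v : P w} (h : u ≤ v) : length u.1 ≤ length v.1 := by
  rcases eq_or_length_lt h with rfl | h
  · exact le_rfl
  · exact h.le

theorem exists_weakLE_of_upEdge {w : Perm (Fin n)} {u v : P w} (h : UpEdge w u v) :
    ∃ x y, nearest w x = u.1 ∧ nearest w y = v.1 ∧ WeakLE x y := by
  obtain ⟨⟨-, hexp⟩, hlen⟩ := h
  obtain ⟨l, hl⟩ := hexp ⟨_, left_mem_segment ℝ _ _⟩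
  let c : Fin n → ℝ := fun i => l (Pi.single i 1)
  have hlc : ∀ p, l p = c ⬝ᵥ p := by
    intro p
    conv_lhs => rw [pi_eq_sum_univ' p]
    simp only [map_sum, map_smul, smul_eq_mul, dotProduct, c]
    exact Finset.sum_congr rfl fun i _ => mul_comm _ _
  have hmax : ∀ z : Perm (Fin n), vec z ∈ segment ℝ (vec u.1) (vec v.1) →
      ∀ p, BruhatLE p w → c ⬝ᵥ vec p ≤ c ⬝ᵥ vec z := by
    intro z hz p hp
    rw [hl] at hz
    rw [← hlc, ← hlc]
    exact hz.2 _ (vec_mem_Q hp)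
  have hmaxu := hmax u.1 (left_mem_segment ℝ _ _)
  have hmaxv := hmax v.1 (right_mem_segment ℝ _ _)
  have hvert : ∀ p, BruhatLE p w → c ⬝ᵥ vec u.1 ≤ c ⬝ᵥ vec p → p = u.1 ∨ p = v.1 := by
    intro p hp hge
    apply eq_or_eq_of_vec_mem_segment
    rw [hl]
    refine ⟨vec_mem_Q hp, fun y hy => ?_⟩
    rw [hlc, hlc]
    exact (dotProduct_le_of_mem_Q hmaxu hy).trans hge
  -- Natural tie-breaking makes `x` weakly below every other sort by `c`, in particular below `xu`
  -- and `xv`.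
  obtain ⟨x, hx⟩ := exists_sort c 1
  obtain ⟨xu, hxu⟩ := exists_sort c u.1⁻¹
  obtain ⟨xv, hxv⟩ := exists_sort c v.1⁻¹
  have hle : ∀ (g y : Perm (Fin n)),
      (∀ a b, y⁻¹ a < y⁻¹ b ↔ c a < c b ∨ (c a = c b ∧ g a < g b)) → WeakLE x y := by
    intro g y hy
    rw [weakLE_iff]
    rintro ⟨a, b⟩ hab
    rw [mem_inversions, hx] at hab
    rw [mem_inversions, hy]
    obtain ⟨h1, h2 | h2⟩ := hab
    · exact ⟨h1, Or.inl h2⟩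
    · exact absurd h2.2 h1.not_gt
  have hnu := nearest_sort u.2 hmaxu hxu
  refine ⟨x, xv, ?_, nearest_sort v.2 hmaxv hxv, hle _ _ hxv⟩
  -- `nearest w x` is an endpoint of the edge. It is not `v`, because `x` is weakly below `xu` and
  -- so `nearest w x` is no longer than `u`.
  refine (hvert _ (nearest_le w x)
    (dotProduct_vec_le_nearest (mem_braidCone_of_sort hx) u.2)).resolve_right fun e => ?_
  have h1 := length_le_of_le (nearest_le_nearest w (hle _ _ hxu))
  simp only [nearestP, e, hnu] at h1
  omega

end EdgeLift

/-! ### The quotient of weak order -/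

section Quotient

variable {n : ℕ}

theorem theta_equivalence (w : Perm (Fin n)) : Equivalence (Theta w) :=
  ⟨fun _ => theta_iff.2 rfl, fun h => theta_iff.2 (theta_iff.1 h).symm,
    fun h h' => theta_iff.2 ((theta_iff.1 h).trans (theta_iff.1 h'))⟩

theorem isClassMin_nearest (w x : Perm (Fin n)) : IsClassMin w x (nearest w x) := by
  refine ⟨theta_iff.2 (nearest_of_le (nearest_le w x)).symm, fun y hy => ?_⟩
  rw [theta_iff.1 hy]
  exact nearest_weakLE w y

theorem isClassMin_bot (w x : Perm (Fin n)) : IsClassMin w x (Bot w x) :=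
  Classical.epsilon_spec ⟨_, isClassMin_nearest w x⟩

theorem bot_eq_nearest (w x : Perm (Fin n)) : Bot w x = nearest w x :=
  ((isClassMin_bot w x).2 _ (isClassMin_nearest w x).1).antisymm
    ((isClassMin_nearest w x).2 _ (isClassMin_bot w x).1)

theorem isClassMax_top (w x : Perm (Fin n)) : IsClassMax w x (Top w x) := by
  obtain ⟨z, hz, hmax, -⟩ := exists_classTop (nearest_le w x)
  exact Classical.epsilon_spec (p := IsClassMax w x)
    ⟨z, theta_iff.2 hz.symm, fun y hy => hmax y (theta_iff.1 hy).symm⟩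

theorem top_eq_of_max {w x z : Perm (Fin n)} (hz : nearest w z = nearest w x)
    (hmax : ∀ y, nearest w y = nearest w x → WeakLE y z) : Top w x = z :=
  (hmax _ (theta_iff.1 (isClassMax_top w x).1).symm).antisymm
    ((isClassMax_top w x).2 _ (theta_iff.2 hz.symm))

theorem top_congr {w x y : Perm (Fin n)} (h : nearest w x = nearest w y) : Top w x = Top w y := by
  refine top_eq_of_max ((theta_iff.1 (isClassMax_top w y).1).symm.trans h.symm) fun z hz => ?_
  exact (isClassMax_top w y).2 z (theta_iff.2 (h ▸ hz.symm))

theorem top_weakLE_top {x y : Perm (Fin n)} (w : Perm (Fin n)) (h : WeakLE x y) :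
    WeakLE (Top w x) (Top w y) := by
  induction h with
  | refl => exact Relation.ReflTransGen.refl
  | @tail y y' _ h ih =>
    obtain ⟨i, j, hij, hlt, rfl⟩ := weakCover_iff.1 h
    obtain ⟨z, hz, hmax, hasc⟩ := exists_classTop (nearest_le w y)
    rw [top_eq_of_max hz hmax] at ih
    exact Relation.ReflTransGen.trans ih (classTop_le_classTop_of_cover hij hlt hz hmax hasc
      fun v hv => (isClassMax_top w _).2 v (theta_iff.2 hv.symm))

theorem cls_eq_iff {w x y : Perm (Fin n)} : cls w x = cls w y ↔ nearest w x = nearest w y := by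
  rw [← theta_iff]
  exact Quot.eq.trans ⟨fun h => (theta_equivalence w).eqvGen_iff.1 h, .rel _ _⟩

/-- Monotonicity of `Top` supplies canonical representatives, which makes the existential relation
on classes transitive. -/
theorem cls_le_iff {w x y : Perm (Fin n)} : cls w x ≤ cls w y ↔ WeakLE (Top w x) (Top w y) := by
  constructor
  · rintro ⟨x', y', hx, hy, h⟩
    rw [← top_congr (cls_eq_iff.1 hx), ← top_congr (cls_eq_iff.1 hy)]
    exact top_weakLE_top w h
  · intro h
    exact ⟨_, _, cls_eq_iff.2 (theta_iff.1 (isClassMax_top w x).1).symm,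
      cls_eq_iff.2 (theta_iff.1 (isClassMax_top w y).1).symm, h⟩

theorem cls_le_cls_of_le {w : Perm (Fin n)} {u v : P w} (h : u ≤ v) : cls w u.1 ≤ cls w v.1 := by
  induction h with
  | refl => exact cls_le_iff.2 Relation.ReflTransGen.refl
  | @tail v v' _ h ih =>
    obtain ⟨x, y, hx, hy, hxy⟩ := exists_weakLE_of_upEdge h
    rw [cls_le_iff] at ih ⊢
    refine Relation.ReflTransGen.trans ih (cls_le_iff.1 ⟨x, y, ?_, ?_, hxy⟩)
    · exact cls_eq_iff.2 (hx.trans (nearest_of_le v.2).symm)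
    · exact cls_eq_iff.2 (hy.trans (nearest_of_le v'.2).symm)

/-- The isomorphism from the quotient of weak order to the 1-skeleton poset. -/
noncomputable def quotientIso (w : Perm (Fin n)) : WeakQuotient w ≃o P w where
  toFun := Quot.lift (nearestP w) fun _ _ h => Subtype.ext (theta_iff.1 h)
  invFun u := cls w u.1
  left_inv := by
    rintro ⟨x⟩
    exact cls_eq_iff.2 (nearest_of_le (nearest_le w x))
  right_inv u := Subtype.ext (nearest_of_le u.2)
  map_rel_iff' := by
    rintro ⟨x⟩ ⟨y⟩
    constructor
    · intro h
      have h1 := cls_le_cls_of_le (u := nearestP w x) (v := nearestP w y) h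
      rwa [cls_eq_iff.2 (nearest_of_le (nearest_le w x) : nearest w (nearestP w x).1 = _),
        cls_eq_iff.2 (nearest_of_le (nearest_le w y) : nearest w (nearestP w y).1 = _)] at h1
    · rintro ⟨x', y', hx, hy, h⟩
      have h1 := nearest_le_nearest w h
      have ex : nearestP w x' = nearestP w x := Subtype.ext (cls_eq_iff.1 hx)
      have ey : nearestP w y' = nearestP w y := Subtype.ext (cls_eq_iff.1 hy)
      rwa [ex, ey] at h1

end Quotient

end BruhatPolytope

theorem theorem4p2 (n : ℕ) (w : Equiv.Perm (Fin n)) :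
    -- `Θ_w` is an equivalence relation, and each of its classes has a weak order minimum
    -- `Bot_w` and a weak order maximum `Top_w`
    Equivalence (BruhatPolytope.Theta w) ∧
    (∀ x, BruhatPolytope.IsClassMin w x (BruhatPolytope.Bot w x)) ∧
    (∀ x, BruhatPolytope.IsClassMax w x (BruhatPolytope.Top w x)) ∧
    -- `Top_w` is order preserving
    (∀ x y, BruhatPolytope.WeakLE x y →
      BruhatPolytope.WeakLE (BruhatPolytope.Top w x) (BruhatPolytope.Top w y)) ∧
    -- `[x]_w ↦ Bot_w(x)` is an isomorphism from the quotient of weak order to `P_w`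
    (∃ φ : BruhatPolytope.WeakQuotient w ≃o BruhatPolytope.P w,
      ∀ x, (φ (BruhatPolytope.cls w x)).1 = BruhatPolytope.Bot w x) :=
  ⟨BruhatPolytope.theta_equivalence w, BruhatPolytope.isClassMin_bot w,
    BruhatPolytope.isClassMax_top w, fun _ _ => BruhatPolytope.top_weakLE_top w,
    BruhatPolytope.quotientIso w, fun x => (BruhatPolytope.bot_eq_nearest w x).symm⟩
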